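/- **Conventions.** Let $\mathbb S$ be the ring of proper real rational functions of $s$ without poles in the closed right half plane $\operatorname{Re}s\ge 0$, and $RL_\infty$ the ring of proper real rational functions without poles on the imaginary axis. A matrix is called stable if its entries lie in $\mathbb S$. For a matrix $G$ over $RL_\infty$ put $G^*(s)=G(-s)^{T}$ (the conjugate transpose of $G$ on the imaginary axis) and $\|G\|_\infty=\sup_{\omega\in\mathbb R}\sigma_{\max}(G(j\omega))$, and let $\operatorname{dist}(G,\mathbb S)=\inf\{\|G-X\|_\infty : X \text{ stable}\}$. A stable matrix $U$ is inner if $U^*U=I$, and outer if $U(s)$ has full row rank for every $s$ with $\operatorname{Re}s>0$. A spectral factor of a square matrix $G$ is an invertible matrix $H$ such that $H$ and $H^{-1}$ are stable and $G=H^*H$. **Theorem.** Let $T_1$ be a $p\times m$ matrix over $RL_\infty$ and $T_2$ a stable $p\times q$ matrix such that the rank of $T_2(j\omega)$ is the same for all $\omega\in\mathbb R\cup\{\infty\}$. Let $T_2=U_iU_o$ be an inner–outer factorization ($U_i$ inner, $U_o$ outer), let $$\gamma=\inf\{\|T_1-T_2Q\|_\infty : Q \text{ a stable } q\times m \text{ matrix}\},$$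 and let $Y=(I-U_iU_i^*)T_1$. For every real $\beta>\|Y\|_\infty$ let $Y_o=Y_o(\beta)$ be a spectral factor of $\beta^2I-Y^*Y$, and put $R=R(\beta)=U_i^*T_1Y_o^{-1}$. Then: 1. $\gamma=\inf\{\beta\in\mathbb R : \|Y\|_\infty<\beta,\ \operatorname{dist}(R(\beta),\mathbb S)<1\}$, the set on the right being non-empty. 2. Let $\beta>\gamma$ (so that $\beta>\|Y\|_\infty$), and let $X$ be a stable matrix with $\|R(\beta)-X\|_\infty\le 1$. Then there is a stable $Q$ with $X=U_oQY_o^{-1}$, and every stable $Q$ with $X=U_oQY_o^{-1}$ satisfies $\|T_1-T_2Q\|_\infty\le\beta$. -/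

import Mathlib

open scoped Matrix

noncomputable section

namespace ModelMatching

/-- Real rational functions `G(s)` that are proper and have no pole in the closed right half
plane (the ring `𝕊` of stable proper real rational functions). `RatFunc.num` and
`RatFunc.denom` are coprime, so the poles are exactly the zeros of `RatFunc.denom`. -/
def stable : Set (RatFunc ℝ) :=
  {f | f.num.natDegree ≤ f.denom.natDegree ∧
    ∀ s : ℂ, 0 ≤ s.re → Polynomial.aeval s f.denom ≠ 0}

/-- Real rational functions that are proper and have no pole on the imaginary axis (`RL∞`). -/
def RLinf : Set (RatFunc ℝ) :=
  {f | f.num.natDegree ≤ f.denom.natDegree ∧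
    ∀ ω : ℝ, Polynomial.aeval (Complex.I * (ω : ℂ)) f.denom ≠ 0}

/-- The matrix `G` has all its entries in the set `A`. -/
def EntriesIn {a b : ℕ} (A : Set (RatFunc ℝ)) (G : Matrix (Fin a) (Fin b) (RatFunc ℝ)) : Prop :=
  ∀ i j, G i j ∈ A

/-- The complex matrix `G(s)`, for a point `s` that is not a pole of `G`. -/
def evalAt {a b : ℕ} (G : Matrix (Fin a) (Fin b) (RatFunc ℝ)) (s : ℂ) :
    Matrix (Fin a) (Fin b) ℂ :=
  G.map fun f => f.eval (algebraMap ℝ ℂ) s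

/-- The real matrix `G(∞)`, for a proper `G`. -/
def evalInfty {a b : ℕ} (G : Matrix (Fin a) (Fin b) (RatFunc ℝ)) : Matrix (Fin a) (Fin b) ℝ :=
  G.map fun f => f.num.coeff f.denom.natDegree / f.denom.leadingCoeff

/-- The adjoint `G^*(s) = G(-s)ᵀ`; on the imaginary axis it is the conjugate transpose. -/
def adj {a b : ℕ} (G : Matrix (Fin a) (Fin b) (RatFunc ℝ)) : Matrix (Fin b) (Fin a) (RatFunc ℝ) :=
  (G.map fun f => f.eval RatFunc.C (-RatFunc.X))ᵀ

/-- The largest singular value of a complex matrix: its operator norm with respect to the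
Euclidean norms. -/
def specNorm {a b : ℕ} (A : Matrix (Fin a) (Fin b) ℂ) : ℝ :=
  ‖LinearMap.toContinuousLinearMap (Matrix.toEuclideanLin A)‖

/-- `‖G‖∞ = sup_ω σ_max (G(jω))`, for a matrix `G` over `RL∞`. -/
def normInf {a b : ℕ} (G : Matrix (Fin a) (Fin b) (RatFunc ℝ)) : ℝ :=
  ⨆ ω : ℝ, specNorm (evalAt G (Complex.I * (ω : ℂ)))

/-- `dist(R, 𝕊)`: the distance, in the norm `‖·‖∞`, from `R` to the stable matrices. -/
def distStable {a b : ℕ} (R : Matrix (Fin a) (Fin b) (RatFunc ℝ)) : ℝ :=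
  ⨅ X : {X : Matrix (Fin a) (Fin b) (RatFunc ℝ) // EntriesIn stable X}, normInf (R - X.1)

/-- The infimal model-matching error `γ = inf {‖T₁ - T₂ Q‖∞ : Q stable}`. -/
def matchingError {p q m : ℕ} (T₁ : Matrix (Fin p) (Fin m) (RatFunc ℝ))
    (T₂ : Matrix (Fin p) (Fin q) (RatFunc ℝ)) : ℝ :=
  ⨅ Q : {Q : Matrix (Fin q) (Fin m) (RatFunc ℝ) // EntriesIn stable Q}, normInf (T₁ - T₂ * Q.1)

/-- Inner: stable with `U^* U = I`. -/
def IsInner {a b : ℕ} (U : Matrix (Fin a) (Fin b) (RatFunc ℝ)) : Prop :=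
  EntriesIn stable U ∧ adj U * U = 1

/-- Outer: stable with full row rank at every point of the open right half plane. -/
def IsOuter {a b : ℕ} (U : Matrix (Fin a) (Fin b) (RatFunc ℝ)) : Prop :=
  EntriesIn stable U ∧ ∀ s : ℂ, 0 < s.re → (evalAt U s).rank = a

/-- The rank of `G(jω)` is the same for all `ω ∈ ℝ ∪ {∞}`. -/
def ConstantRankOnAxis {a b : ℕ} (G : Matrix (Fin a) (Fin b) (RatFunc ℝ)) : Prop :=
  ∀ ω : ℝ, (evalAt G (Complex.I * (ω : ℂ))).rank = (evalInfty G).rank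

/-- `H` is a spectral factor of `G`: `G = H^* H` with `H` invertible and `H`, `H⁻¹` stable. -/
def IsSpectralFactor {m : ℕ} (G H : Matrix (Fin m) (Fin m) (RatFunc ℝ)) : Prop :=
  EntriesIn stable H ∧ IsUnit H.det ∧ EntriesIn stable H⁻¹ ∧ G = adj H * H

/-- `Y = (I - Uᵢ Uᵢ^*) T₁`. -/
def residual {p r m : ℕ} (Ui : Matrix (Fin p) (Fin r) (RatFunc ℝ))
    (T₁ : Matrix (Fin p) (Fin m) (RatFunc ℝ)) : Matrix (Fin p) (Fin m) (RatFunc ℝ) :=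
  (1 - Ui * adj Ui) * T₁

end ModelMatching

end

/-! Write `U` for the inner factor, `H` for the spectral factor, `W = Uo * Q` and `X = W * H⁻¹`. On
the imaginary axis `T₁ - U W = U (U^* T₁ - W) + Y`, where `U` is isometric and `U^* Y = 0`, so
squared norms add (`norm_sq_error`). Also `β²|v|² = |Hv|² + |Yv|²` (`norm_sq_spectralFactor`).
Eliminating `Y` gives `|(T₁ - U W) v|² = |(R - X) H v|² + β²|v|² - |H v|²`. Hence `‖R - X‖∞ ≤ 1`
forces an error of at most `β` (`normInf_error_le`), and an error below `β` forces `‖R - X‖∞ < 1`,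
since the gap is uniform in the frequency (`normInf_normalised_lt_one`).

It remains to see that `Q ↦ Uo * Q * H⁻¹` reaches every stable `X`. As `H` is a unit over the stable
ring, a stable right inverse of `Uo` suffices. Constant rank of `T₂` extends the full row rank of
`Uo` to the axis and to infinity (`rank_evalAt_outer_eq`). The maximal minors of `Uo` then have no
common zero there, so they generate the unit ideal (`one_mem_of_no_common_zero`), and their
adjugates combine to a right inverse. -/

noncomputable section

namespace ModelMatching

open Polynomial Filter Topology

/-! ### Rings of proper rational functions and their evaluations -/

section ProperRational

/-- The ratio of two polynomials as a rational function. -/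
def ratio (n d : ℝ[X]) : RatFunc ℝ := algebraMap ℝ[X] (RatFunc ℝ) n / algebraMap ℝ[X] (RatFunc ℝ) d

/-- The proper real rational functions without poles in `Z`. -/
def properOn (Z : Set ℂ) : Set (RatFunc ℝ) :=
  {f | f.num.natDegree ≤ f.denom.natDegree ∧ ∀ s ∈ Z, aeval s f.denom ≠ 0}

variable {Z : Set ℂ}

lemma ratio_num_denom (f : RatFunc ℝ) : ratio f.num f.denom = f := RatFunc.num_div_denom f

lemma num_ratio_mul {n d : ℝ[X]} (hd : d ≠ 0) : (ratio n d).num * d = n * (ratio n d).denom :=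
  (RatFunc.num_mul_eq_mul_denom_iff hd).2 rfl

lemma algebraMap_ratFunc_ne_zero {d : ℝ[X]} (hd : d ≠ 0) : algebraMap ℝ[X] (RatFunc ℝ) d ≠ 0 :=
  RatFunc.algebraMap_ne_zero hd

lemma ratio_add {n₁ d₁ n₂ d₂ : ℝ[X]} (h₁ : d₁ ≠ 0) (h₂ : d₂ ≠ 0) :
    ratio n₁ d₁ + ratio n₂ d₂ = ratio (n₁ * d₂ + n₂ * d₁) (d₁ * d₂) := by
  have h₁ := algebraMap_ratFunc_ne_zero h₁
  have h₂ := algebraMap_ratFunc_ne_zero h₂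
  simp only [ratio, map_add, map_mul]
  field_simp

lemma ratio_mul (n₁ d₁ n₂ d₂ : ℝ[X]) :
    ratio n₁ d₁ * ratio n₂ d₂ = ratio (n₁ * n₂) (d₁ * d₂) := by
  simp only [ratio, map_mul, div_mul_div_comm]

/-- Allows membership to be tested on any fraction: the reduced denominator divides `d`, and
cancelling a common factor lowers both degrees equally. -/
lemma ratio_mem_properOn {n d : ℝ[X]} (hd : d ≠ 0) (hdeg : n.natDegree ≤ d.natDegree)
    (hZ : ∀ s ∈ Z, aeval s d ≠ 0) : ratio n d ∈ properOn Z := by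
  refine ⟨?_, fun s hs h0 => hZ s hs ?_⟩
  · by_cases hn : n = 0
    · simp [ratio, hn]
    · have h := num_ratio_mul (n := n) hd
      have hden := RatFunc.denom_ne_zero (ratio n d)
      have hnum : (ratio n d).num ≠ 0 := by
        intro h0
        rw [h0, zero_mul] at h
        exact mul_ne_zero hn hden h.symm
      have := congrArg natDegree h
      rw [natDegree_mul hnum hd, natDegree_mul hn hden] at this
      omega
  · obtain ⟨c, hc⟩ := RatFunc.denom_div_dvd n d
    rw [hc, map_mul]
    exact mul_eq_zero_of_left h0 _

lemma properOn.exists_ratio {f : RatFunc ℝ} (hf : f ∈ properOn Z) :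
    ∃ n d : ℝ[X], d ≠ 0 ∧ n.natDegree ≤ d.natDegree ∧ (∀ s ∈ Z, aeval s d ≠ 0) ∧ f = ratio n d :=
  ⟨f.num, f.denom, f.denom_ne_zero, hf.1, hf.2, (ratio_num_denom f).symm⟩

lemma aeval_mul_ne_zero {d₁ d₂ : ℝ[X]} (h₁ : ∀ s ∈ Z, aeval s d₁ ≠ 0)
    (h₂ : ∀ s ∈ Z, aeval s d₂ ≠ 0) : ∀ s ∈ Z, aeval s (d₁ * d₂) ≠ 0 := fun s hs => by
  rw [map_mul]
  exact mul_ne_zero (h₁ s hs) (h₂ s hs)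

lemma C_mem_properOn (c : ℝ) : RatFunc.C c ∈ properOn Z := by
  refine ⟨?_, fun s _ => ?_⟩ <;> simp

variable (Z) in
/-- The proper real rational functions without poles in `Z`, as a ring. -/
def properRing : Subring (RatFunc ℝ) where
  carrier := properOn Z
  mul_mem' := by
    intro f g hf hg
    obtain ⟨n₁, d₁, h₁, hdeg₁, hZ₁, rfl⟩ := properOn.exists_ratio hf
    obtain ⟨n₂, d₂, h₂, hdeg₂, hZ₂, rfl⟩ := properOn.exists_ratio hg
    rw [ratio_mul]
    refine ratio_mem_properOn (mul_ne_zero h₁ h₂) ?_ (aeval_mul_ne_zero hZ₁ hZ₂)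
    rw [natDegree_mul h₁ h₂]
    exact natDegree_mul_le_of_le hdeg₁ hdeg₂
  one_mem' := by simpa using C_mem_properOn (Z := Z) 1
  add_mem' := by
    intro f g hf hg
    obtain ⟨n₁, d₁, h₁, hdeg₁, hZ₁, rfl⟩ := properOn.exists_ratio hf
    obtain ⟨n₂, d₂, h₂, hdeg₂, hZ₂, rfl⟩ := properOn.exists_ratio hg
    rw [ratio_add h₁ h₂]
    refine ratio_mem_properOn (mul_ne_zero h₁ h₂) ?_ (aeval_mul_ne_zero hZ₁ hZ₂)
    rw [natDegree_mul h₁ h₂]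
    refine natDegree_add_le_of_degree_le (natDegree_mul_le_of_le hdeg₁ le_rfl) ?_
    rw [add_comm]
    exact natDegree_mul_le_of_le hdeg₂ le_rfl
  zero_mem' := by simpa using C_mem_properOn (Z := Z) 0
  neg_mem' := by
    intro f hf
    obtain ⟨n, d, h, hdeg, hZ, rfl⟩ := properOn.exists_ratio hf
    have : -ratio n d = ratio (-n) d := by simp [ratio, neg_div]
    rw [this]
    exact ratio_mem_properOn h (by simpa using hdeg) hZ

lemma eval_ratio {n d : ℝ[X]} {s : ℂ} (hd : aeval s d ≠ 0) :
    (ratio n d).eval (algebraMap ℝ ℂ) s = aeval s n / aeval s d := by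
  have hd0 : d ≠ 0 := by rintro rfl; simp at hd
  have hden : aeval s (ratio n d).denom ≠ 0 := fun h0 => hd (by
    obtain ⟨c, hc⟩ := RatFunc.denom_div_dvd n d
    rw [hc, map_mul]
    exact mul_eq_zero_of_left h0 _)
  have h := congrArg (aeval s) (num_ratio_mul (n := n) hd0)
  rw [map_mul, map_mul] at h
  change aeval s (ratio n d).num / aeval s (ratio n d).denom = _
  rw [div_eq_div_iff hden hd, h]

/-- Evaluation at a point of `Z`. -/
def evalHom {s : ℂ} (hs : s ∈ Z) : properRing Z →+* ℂ where
  toFun f := f.1.eval (algebraMap ℝ ℂ) s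
  map_one' := by simp
  map_zero' := by simp
  map_mul' f g := RatFunc.eval_mul _ _ (f.2.2 s hs) (g.2.2 s hs)
  map_add' f g := RatFunc.eval_add _ _ (f.2.2 s hs) (g.2.2 s hs)

/-- The value at infinity of a proper rational function. -/
def valueInfty (f : RatFunc ℝ) : ℝ := f.num.coeff f.denom.natDegree / f.denom.leadingCoeff

/-- Compare the coefficients of top possible degree in `num * d = n * denom`. -/
lemma valueInfty_ratio {n d : ℝ[X]} (hd : d ≠ 0) (hdeg : n.natDegree ≤ d.natDegree) :
    valueInfty (ratio n d) = n.coeff d.natDegree / d.leadingCoeff := by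
  have hmem : ratio n d ∈ properOn (∅ : Set ℂ) := ratio_mem_properOn hd hdeg (by simp)
  have hden := RatFunc.denom_ne_zero (ratio n d)
  have h := congrArg (fun p => coeff p ((ratio n d).denom.natDegree + d.natDegree))
    (num_ratio_mul (n := n) hd)
  beta_reduce at h
  rw [coeff_mul_add_eq_of_natDegree_le hmem.1 le_rfl, add_comm,
    coeff_mul_add_eq_of_natDegree_le hdeg le_rfl] at h
  rw [valueInfty, div_eq_div_iff (leadingCoeff_ne_zero.2 hden) (leadingCoeff_ne_zero.2 hd)]
  exact h

variable (Z) in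
/-- Evaluation at infinity. -/
def inftyHom : properRing Z →+* ℝ where
  toFun f := valueInfty f.1
  map_one' := by simp [valueInfty]
  map_zero' := by simp [valueInfty]
  map_mul' := by
    rintro ⟨f, hf⟩ ⟨g, hg⟩
    obtain ⟨n₁, d₁, h₁, hdeg₁, -, rfl⟩ := properOn.exists_ratio hf
    obtain ⟨n₂, d₂, h₂, hdeg₂, -, rfl⟩ := properOn.exists_ratio hg
    change valueInfty (ratio n₁ d₁ * ratio n₂ d₂) = _
    rw [ratio_mul, valueInfty_ratio (mul_ne_zero h₁ h₂), valueInfty_ratio h₁ hdeg₁,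
      valueInfty_ratio h₂ hdeg₂, natDegree_mul h₁ h₂, leadingCoeff_mul,
      coeff_mul_add_eq_of_natDegree_le hdeg₁ hdeg₂, div_mul_div_comm]
    rw [natDegree_mul h₁ h₂]
    exact natDegree_mul_le_of_le hdeg₁ hdeg₂
  map_add' := by
    rintro ⟨f, hf⟩ ⟨g, hg⟩
    obtain ⟨n₁, d₁, h₁, hdeg₁, -, rfl⟩ := properOn.exists_ratio hf
    obtain ⟨n₂, d₂, h₂, hdeg₂, -, rfl⟩ := properOn.exists_ratio hg
    change valueInfty (ratio n₁ d₁ + ratio n₂ d₂) = _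
    have hl₁ := leadingCoeff_ne_zero.2 h₁
    have hl₂ := leadingCoeff_ne_zero.2 h₂
    have e : d₁.natDegree + d₂.natDegree = d₂.natDegree + d₁.natDegree := add_comm _ _
    rw [ratio_add h₁ h₂, valueInfty_ratio (mul_ne_zero h₁ h₂), valueInfty_ratio h₁ hdeg₁,
      valueInfty_ratio h₂ hdeg₂, natDegree_mul h₁ h₂, leadingCoeff_mul, coeff_add,
      coeff_mul_add_eq_of_natDegree_le hdeg₁ le_rfl, e,
      coeff_mul_add_eq_of_natDegree_le hdeg₂ le_rfl, div_add_div _ _ hl₁ hl₂]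
    · simp only [leadingCoeff]
      ring
    rw [natDegree_mul h₁ h₂]
    refine natDegree_add_le_of_degree_le (natDegree_mul_le_of_le hdeg₁ le_rfl) ?_
    rw [add_comm]
    exact natDegree_mul_le_of_le hdeg₂ le_rfl

end ProperRational

/-! ### A Bézout criterion for stable functions -/

section Bezout

/-- The closed right half plane. -/
def closedRightHalfPlane : Set ℂ := {s | 0 ≤ s.re}

/-- The imaginary axis. -/
def imaginaryAxis : Set ℂ := Set.range fun ω : ℝ => Complex.I * (ω : ℂ)

lemma stable_eq_properOn : stable = properOn closedRightHalfPlane := rfl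

lemma RLinf_eq_properOn : RLinf = properOn imaginaryAxis := by
  simp [RLinf, properOn, imaginaryAxis]

lemma imaginaryAxis_subset : imaginaryAxis ⊆ closedRightHalfPlane := by
  rintro _ ⟨ω, rfl⟩
  simp [closedRightHalfPlane]

lemma stable_subset_RLinf : stable ⊆ RLinf := by
  rw [stable_eq_properOn, RLinf_eq_properOn]
  exact fun f hf => ⟨hf.1, fun s hs => hf.2 s (imaginaryAxis_subset hs)⟩

lemma ratio_mem_stable {n d : ℝ[X]} (hd : d ≠ 0) (hdeg : n.natDegree ≤ d.natDegree)
    (hZ : ∀ s : ℂ, 0 ≤ s.re → aeval s d ≠ 0) : ratio n d ∈ stable :=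
  ratio_mem_properOn hd hdeg hZ

lemma X_add_one_ne_zero : (X + 1 : ℝ[X]) ≠ 0 := by simpa using X_add_C_ne_zero (1 : ℝ)

lemma natDegree_X_add_one_pow (k : ℕ) : ((X + 1 : ℝ[X]) ^ k).natDegree = k := by
  simpa using natDegree_pow_X_add_C (R := ℝ) k 1

lemma aeval_X_add_one_pow_ne_zero (k : ℕ) (s : ℂ) (hs : 0 ≤ s.re) :
    aeval s ((X + 1 : ℝ[X]) ^ k) ≠ 0 := by
  rw [map_pow]
  refine pow_ne_zero _ fun h => ?_
  have := congrArg Complex.re h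
  simp at this
  linarith

lemma ratio_X_add_one_pow_mem_stable {n : ℝ[X]} {k : ℕ} (h : n.natDegree ≤ k) :
    ratio n ((X + 1) ^ k) ∈ stable :=
  ratio_mem_stable (pow_ne_zero _ X_add_one_ne_zero) (by rwa [natDegree_X_add_one_pow])
    (aeval_X_add_one_pow_ne_zero k)

/-- An ideal of the ring of stable functions that has no common zero in the closed right half
plane nor at infinity contains `1`. -/
theorem one_mem_of_no_common_zero (I : Set (RatFunc ℝ)) (hsub : I ⊆ stable)
    (hadd : ∀ f ∈ I, ∀ g ∈ I, f + g ∈ I) (hmul : ∀ a ∈ stable, ∀ f ∈ I, a * f ∈ I)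
    (hfin : ∀ s : ℂ, 0 ≤ s.re → ∃ f ∈ I, f.eval (algebraMap ℝ ℂ) s ≠ 0)
    (hinf : ∃ f ∈ I, valueInfty f ≠ 0) : (1 : RatFunc ℝ) ∈ I := by
  have hw (k : ℕ) : ((X + 1 : ℝ[X]) ^ k) ≠ 0 := pow_ne_zero _ X_add_one_ne_zero
  have h0 : (0 : RatFunc ℝ) ∈ I := by
    obtain ⟨f, hf, -⟩ := hinf
    simpa using hmul 0 (properRing closedRightHalfPlane).zero_mem f hf
  -- Powers of `X + 1` serve as common stable denominators, so `I` is governed by an ideal of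
  -- numerators in the principal ideal domain `ℝ[X]`. Its generator `g` divides the numerator of
  -- every element of `I`, hence has no zero in the closed half plane, and `1 / g` is stable.
  let K : Ideal ℝ[X] :=
    { carrier := {n | ∃ k, ratio n ((X + 1) ^ k) ∈ I}
      zero_mem' := ⟨0, by simpa [ratio] using h0⟩
      add_mem' := by
        rintro a b ⟨k, hk⟩ ⟨l, hl⟩
        refine ⟨k + l, ?_⟩
        have h₁ := hmul _ (ratio_X_add_one_pow_mem_stable (n := 1) (k := l) (by simp)) _ hk
        have h₂ := hmul _ (ratio_X_add_one_pow_mem_stable (n := 1) (k := k) (by simp)) _ hl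
        convert hadd _ h₁ _ h₂ using 1
        rw [ratio_mul, ratio_mul, ← pow_add, ← pow_add, add_comm l k]
        simp [ratio, add_div]
      smul_mem' := by
        rintro c a ⟨k, hk⟩
        refine ⟨c.natDegree + k, ?_⟩
        have h := hmul _ (ratio_X_add_one_pow_mem_stable (n := c) le_rfl) _ hk
        rwa [ratio_mul, ← pow_add] at h }
  have hK {n : ℝ[X]} : n ∈ K ↔ ∃ k, ratio n ((X + 1) ^ k) ∈ I := Iff.rfl
  have hnum {f : RatFunc ℝ} (hf : f ∈ I) : f.num ∈ K := by
    refine hK.2 ⟨f.denom.natDegree, ?_⟩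
    have h := hmul _ (ratio_X_add_one_pow_mem_stable (n := f.denom) le_rfl) _ hf
    have hd := algebraMap_ratFunc_ne_zero f.denom_ne_zero
    have hf' : algebraMap ℝ[X] (RatFunc ℝ) f.denom * f = algebraMap ℝ[X] (RatFunc ℝ) f.num := by
      rw [mul_comm, ← eq_div_iff hd, RatFunc.num_div_denom]
    rwa [ratio, div_mul_eq_mul_div, hf'] at h
  obtain ⟨g, hg⟩ := (IsPrincipalIdealRing.principal K).principal
  have hgK : g ∈ K := by rw [hg]; exact Submodule.mem_span_singleton_self g
  have hdvd {n : ℝ[X]} (hn : n ∈ K) : g ∣ n := by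
    rw [hg] at hn
    exact Ideal.mem_span_singleton.1 hn
  have hgs (s : ℂ) (hs : 0 ≤ s.re) : aeval s g ≠ 0 := by
    intro hgs
    obtain ⟨f, hf, hfs⟩ := hfin s hs
    obtain ⟨c, hc⟩ := hdvd (hnum hf)
    apply hfs
    change aeval s f.num / _ = 0
    rw [hc, map_mul, hgs, zero_mul, zero_div]
  have hg0 : g ≠ 0 := by
    rintro rfl
    exact hgs 0 le_rfl (map_zero _)
  obtain ⟨k, hk⟩ := hK.1 hgK
  have hk1 : ratio 1 ((X + 1) ^ k) ∈ I := by
    have h := hmul _ (ratio_mem_stable (n := 1) hg0 (by simp) hgs) _ hk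
    convert h using 1
    have hg' := algebraMap_ratFunc_ne_zero hg0
    have hwd := algebraMap_ratFunc_ne_zero (hw k)
    simp only [ratio]
    field_simp
  -- With `v = f(∞) ≠ 0`, the function `1 - v⁻¹ f` vanishes at infinity, so it stays proper after
  -- multiplication by `X + 1`. Now split `1 / (X+1)^j` as `v⁻¹ f / (X+1)^j + (1 - v⁻¹ f)(X+1) /
  -- (X+1)^(j+1)`.
  have hstep (j : ℕ) (hj : ratio 1 ((X + 1) ^ (j + 1)) ∈ I) : ratio 1 ((X + 1) ^ j) ∈ I := by
    obtain ⟨f, hf, hfv⟩ := hinf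
    obtain ⟨n, d, hd, hdeg, hZ, rfl⟩ := properOn.exists_ratio (hsub hf)
    rw [valueInfty_ratio hd hdeg] at hfv
    set v := n.coeff d.natDegree / d.leadingCoeff with hv
    have hl := leadingCoeff_ne_zero.2 hd
    have hrem : ratio ((d - C v⁻¹ * n) * (X + 1)) d ∈ stable := by
      refine ratio_mem_stable hd ?_ hZ
      by_cases hz : d - C v⁻¹ * n = 0
      · simp [hz]
      have hle : (d - C v⁻¹ * n).natDegree ≤ d.natDegree :=
        by
        simpa using natDegree_sub_le_of_le (le_refl d.natDegree)
          ((natDegree_C_mul_le v⁻¹ n).trans hdeg)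
      have hco : (d - C v⁻¹ * n).coeff d.natDegree = 0 := by
        have hn : n.coeff d.natDegree ≠ 0 := fun h => hfv (by simp [hv, h])
        rw [coeff_sub, coeff_C_mul, hv, coeff_natDegree]
        field_simp
        simp
      have hlt : (d - C v⁻¹ * n).natDegree < d.natDegree := by
        refine lt_of_le_of_ne hle fun h => hz ?_
        rw [← h] at hco
        exact leadingCoeff_eq_zero.1 hco
      rw [natDegree_mul hz X_add_one_ne_zero, ← pow_one (X + 1 : ℝ[X]), natDegree_X_add_one_pow]
      exact hlt
    have hc := hmul _ (ratio_X_add_one_pow_mem_stable (n := C v⁻¹) (k := j) (by simp)) _ hf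
    convert hadd _ hc _ (hmul _ hrem _ hj) using 1
    have hd' := algebraMap_ratFunc_ne_zero hd
    have hw' := algebraMap_ratFunc_ne_zero X_add_one_ne_zero
    simp only [ratio, map_mul, map_sub, map_pow, pow_succ, map_one]
    field_simp
    ring
  have hall : ∀ j, ratio 1 ((X + 1) ^ j) ∈ I → ratio 1 ((X + 1) ^ 0) ∈ I := by
    intro j
    induction j with
    | zero => exact id
    | succ j ih => exact fun h => ih (hstep j h)
  simpa [ratio] using hall k hk1

end Bezout

/-! ### Full row rank and maximal minors -/

section LinearAlgebra

variable {K : Type*} [Field K] {a b : ℕ}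

lemma exists_minor_ne_zero (A : Matrix (Fin a) (Fin b) K) (h : A.rank = a) :
    ∃ e : Fin a → Fin b, (A.submatrix id e).det ≠ 0 := by
  rw [Matrix.rank_eq_finrank_span_cols] at h
  obtain ⟨f, hf, -, hli⟩ := Submodule.exists_fun_fin_finrank_span_eq K (Set.range A.col)
  choose e he using hf
  refine ⟨fun i => e (finCongr h.symm i), ?_⟩
  rw [← isUnit_iff_ne_zero, ← Matrix.isUnit_iff_isUnit_det,
    ← Matrix.linearIndependent_cols_iff_isUnit]
  have : (A.submatrix id fun i => e (finCongr h.symm i)).col = f ∘ finCongr h.symm := by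
    funext i
    rw [Function.comp_apply, ← he]
    rfl
  rw [this]
  exact hli.comp _ (finCongr h.symm).injective

/-- Selecting columns as a right multiplication: it turns the adjugate of a minor into a right
factor of `A`, and bounds the rank of the minor by that of `A`. -/
lemma submatrix_eq_mul {R : Type*} [CommRing R] (A : Matrix (Fin a) (Fin b) R)
    (e : Fin a → Fin b) :
    A.submatrix id e = A * (1 : Matrix (Fin b) (Fin b) R).submatrix id e := by
  ext i j
  simp [Matrix.mul_apply, Matrix.one_apply]

lemma rank_eq_of_minor_ne_zero (A : Matrix (Fin a) (Fin b) K) (e : Fin a → Fin b)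
    (h : (A.submatrix id e).det ≠ 0) : A.rank = a := by
  refine le_antisymm (by simpa using A.rank_le_card_height) ?_
  have hu : IsUnit (A.submatrix id e) := (Matrix.isUnit_iff_isUnit_det _).2 (isUnit_iff_ne_zero.2 h)
  have hr := Matrix.rank_of_isUnit _ hu
  rw [Fintype.card_fin, submatrix_eq_mul] at hr
  exact hr.symm.le.trans (Matrix.rank_mul_le_left _ _)

end LinearAlgebra

/-! ### Matrices over these rings and their evaluations -/

section Entries

variable {Z : Set ℂ} {a b c : ℕ} {G G' : Matrix (Fin a) (Fin b) (RatFunc ℝ)}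
  {H : Matrix (Fin b) (Fin c) (RatFunc ℝ)}

/-- A matrix with entries in `properOn Z`, as a matrix over `properRing Z`. -/
def EntriesIn.lift (hG : EntriesIn (properOn Z) G) : Matrix (Fin a) (Fin b) (properRing Z) :=
  Matrix.of fun i j => ⟨G i j, hG i j⟩

lemma EntriesIn.map_lift (hG : EntriesIn (properOn Z) G) :
    hG.lift.map (properRing Z).subtype = G := rfl

lemma entriesIn_map (M : Matrix (Fin a) (Fin b) (properRing Z)) :
    EntriesIn (properOn Z) (M.map (properRing Z).subtype) := fun i j => (M i j).2

lemma EntriesIn.mul (hG : EntriesIn (properOn Z) G) (hH : EntriesIn (properOn Z) H) :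
    EntriesIn (properOn Z) (G * H) := by
  rw [← hG.map_lift, ← hH.map_lift, ← Matrix.map_mul]
  exact entriesIn_map _

lemma EntriesIn.sub (hG : EntriesIn (properOn Z) G) (hG' : EntriesIn (properOn Z) G') :
    EntriesIn (properOn Z) (G - G') :=
  fun i j => (properRing Z).sub_mem (hG i j) (hG' i j)

lemma entriesIn_one : EntriesIn (properOn Z) (1 : Matrix (Fin a) (Fin a) (RatFunc ℝ)) :=
  fun i j => by
    rw [Matrix.one_apply]
    split_ifs
    exacts [(properRing Z).one_mem, (properRing Z).zero_mem]

lemma EntriesIn.mono {A B : Set (RatFunc ℝ)} (hG : EntriesIn A G) (h : A ⊆ B) : EntriesIn B G :=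
  fun i j => h (hG i j)

variable {s : ℂ}

lemma EntriesIn.evalAt_eq (hG : EntriesIn (properOn Z) G) (hs : s ∈ Z) :
    evalAt G s = hG.lift.map (evalHom hs) := rfl

lemma EntriesIn.evalInfty_eq (hG : EntriesIn (properOn Z) G) :
    evalInfty G = hG.lift.map (inftyHom Z) := rfl

lemma evalAt_mul (hG : EntriesIn (properOn Z) G) (hH : EntriesIn (properOn Z) H) (hs : s ∈ Z) :
    evalAt (G * H) s = evalAt G s * evalAt H s := by
  rw [hG.evalAt_eq hs, hH.evalAt_eq hs, ← Matrix.map_mul, (hG.mul hH).evalAt_eq hs]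
  congr 1
  ext i j
  exact congrFun (congrFun (Matrix.map_mul (f := (properRing Z).subtype) (L := hG.lift)
    (M := hH.lift)).symm i) j

lemma evalInfty_mul (hG : EntriesIn (properOn Z) G) (hH : EntriesIn (properOn Z) H) :
    evalInfty (G * H) = evalInfty G * evalInfty H := by
  rw [hG.evalInfty_eq, hH.evalInfty_eq, ← Matrix.map_mul, (hG.mul hH).evalInfty_eq]
  congr 1
  ext i j
  exact congrFun (congrFun (Matrix.map_mul (f := (properRing Z).subtype) (L := hG.lift)
    (M := hH.lift)).symm i) j

lemma evalAt_sub (hG : EntriesIn (properOn Z) G) (hG' : EntriesIn (properOn Z) G') (hs : s ∈ Z) :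
    evalAt (G - G') s = evalAt G s - evalAt G' s := by
  ext i j
  exact map_sub (evalHom hs) ⟨G i j, hG i j⟩ ⟨G' i j, hG' i j⟩

lemma evalAt_add (hG : EntriesIn (properOn Z) G) (hG' : EntriesIn (properOn Z) G') (hs : s ∈ Z) :
    evalAt (G + G') s = evalAt G s + evalAt G' s := by
  ext i j
  exact map_add (evalHom hs) ⟨G i j, hG i j⟩ ⟨G' i j, hG' i j⟩

lemma evalAt_zero : evalAt (0 : Matrix (Fin a) (Fin b) (RatFunc ℝ)) s = 0 := by
  ext i j
  simp [evalAt]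

lemma evalAt_one : evalAt (1 : Matrix (Fin a) (Fin a) (RatFunc ℝ)) s = 1 := by
  simp [evalAt]

end Entries

/-! ### Stable right inverses of outer matrices -/

section RightInverse

variable {a b : ℕ}

/-- A stable matrix of full row rank on the closed right half plane and at infinity has a stable
right inverse. -/
theorem exists_stable_right_inverse (U : Matrix (Fin a) (Fin b) (RatFunc ℝ))
    (hU : EntriesIn stable U) (hfin : ∀ s : ℂ, 0 ≤ s.re → (evalAt U s).rank = a)
    (hinf : (evalInfty U).rank = a) :
    ∃ V : Matrix (Fin b) (Fin a) (RatFunc ℝ), EntriesIn stable V ∧ U * V = 1 := by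
  rw [stable_eq_properOn] at hU
  let S := properRing closedRightHalfPlane
  -- The `d` for which `U V = d • 1` is solvable in stable `V`: an ideal containing all maximal
  -- minors, by Cramer's rule.
  let I : Set (RatFunc ℝ) := {f | ∃ d : S, (d : RatFunc ℝ) = f ∧
    ∃ V : Matrix (Fin b) (Fin a) S, hU.lift * V = d • (1 : Matrix (Fin a) (Fin a) S)}
  have hminor (e : Fin a → Fin b) : ((hU.lift.submatrix id e).det : RatFunc ℝ) ∈ I := by
    refine ⟨_, rfl, (1 : Matrix (Fin b) (Fin b) S).submatrix id e *
      (hU.lift.submatrix id e).adjugate, ?_⟩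
    rw [← Matrix.mul_assoc, ← submatrix_eq_mul, Matrix.mul_adjugate]
  have h1 : (1 : RatFunc ℝ) ∈ I := by
    refine one_mem_of_no_common_zero I ?_ ?_ ?_ ?_ ?_
    · rintro _ ⟨d, rfl, -⟩
      exact d.2
    · rintro _ ⟨d, rfl, V, hV⟩ _ ⟨d', rfl, V', hV'⟩
      exact ⟨d + d', rfl, V + V', by rw [Matrix.mul_add, hV, hV', add_smul]⟩
    · rintro c hc _ ⟨d, rfl, V, hV⟩
      exact ⟨⟨c, hc⟩ * d, rfl, (⟨c, hc⟩ : S) • V, by rw [Matrix.mul_smul, hV, smul_smul]⟩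
    · intro s hs
      obtain ⟨e, he⟩ := exists_minor_ne_zero _ (hfin s hs)
      refine ⟨_, hminor e, fun h => he ?_⟩
      rw [hU.evalAt_eq hs]
      exact ((evalHom (Z := closedRightHalfPlane) hs).map_det (hU.lift.submatrix id e)).symm.trans h
    · obtain ⟨e, he⟩ := exists_minor_ne_zero _ hinf
      refine ⟨_, hminor e, fun h => he ?_⟩
      rw [hU.evalInfty_eq]
      exact ((inftyHom closedRightHalfPlane).map_det (hU.lift.submatrix id e)).symm.trans h
  obtain ⟨d, hd, V, hV⟩ := h1
  refine ⟨V.map S.subtype, entriesIn_map V, ?_⟩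
  have hd1 : d = 1 := Subtype.ext hd
  rw [hd1, one_smul] at hV
  have h := congrArg (fun M => M.map S.subtype) hV
  simp only [Matrix.map_mul] at h
  rw [hU.map_lift] at h
  rw [h]
  exact Matrix.map_one _ (map_zero _) (map_one _)

lemma exists_axis_eval_ne_zero {f : RatFunc ℝ} (hf : f ∈ stable) (h0 : f ≠ 0) :
    ∃ ω : ℝ, f.eval (algebraMap ℝ ℂ) (Complex.I * (ω : ℂ)) ≠ 0 := by
  by_contra! h
  have hnum : f.num.map (algebraMap ℝ ℂ) ≠ 0 :=
    (Polynomial.map_ne_zero_iff (algebraMap ℝ ℂ).injective).2 (RatFunc.num_ne_zero h0)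
  refine hnum (Polynomial.eq_zero_of_infinite_isRoot _ ?_)
  refine (Set.infinite_range_of_injective (f := fun ω : ℝ => Complex.I * (ω : ℂ)) ?_).mono ?_
  · intro x y hxy
    simpa using hxy
  · rintro _ ⟨ω, rfl⟩
    have hden := (stable_subset_RLinf hf).2 ω
    have := h ω
    change Polynomial.aeval _ f.num / Polynomial.aeval _ f.denom = 0 at this
    rw [div_eq_zero_iff, or_iff_left hden] at this
    simpa [Polynomial.IsRoot, Polynomial.eval_map_algebraMap] using this

/-- A maximal minor that is nonzero at `s = 1` is a nonzero rational function, so it cannot vanish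
on the whole axis. -/
lemma IsOuter.exists_axis_rank {U : Matrix (Fin a) (Fin b) (RatFunc ℝ)} (hU : IsOuter U) :
    ∃ ω : ℝ, (evalAt U (Complex.I * (ω : ℂ))).rank = a := by
  have hU' := hU.1
  rw [stable_eq_properOn] at hU'
  have h1 : (1 : ℂ) ∈ closedRightHalfPlane := by simp [closedRightHalfPlane]
  obtain ⟨e, he⟩ := exists_minor_ne_zero _ (hU.2 1 (by simp))
  rw [hU'.evalAt_eq h1] at he
  have hdet : (hU'.lift.submatrix id e).det ≠ 0 := by
    intro h
    refine he (((evalHom h1).map_det (hU'.lift.submatrix id e)).symm.trans ?_)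
    rw [h, map_zero]
  obtain ⟨ω, hω⟩ := exists_axis_eval_ne_zero (hU'.lift.submatrix id e).det.2
    fun h => hdet (Subtype.ext h)
  refine ⟨ω, rank_eq_of_minor_ne_zero _ e fun h => hω ?_⟩
  have hs : Complex.I * (ω : ℂ) ∈ closedRightHalfPlane := imaginaryAxis_subset ⟨ω, rfl⟩
  rw [hU'.evalAt_eq hs] at h
  exact ((evalHom hs).map_det (hU'.lift.submatrix id e)).trans h

end RightInverse

/-! ### Boundedness on the imaginary axis -/

section Boundedness

lemma aeval_eq_aeval_inv_reflect {p : Polynomial ℝ} {k : ℕ} (hp : p.natDegree ≤ k) {z : ℂ}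
    (hz : z ≠ 0) :
    Polynomial.aeval z p = Polynomial.aeval z⁻¹ (Polynomial.reflect k p) * z ^ k := by
  let := invertibleOfNonzero hz
  have h := Polynomial.eval₂_reflect_mul_pow (algebraMap ℝ ℂ) z k p hp
  rw [invOf_eq_inv] at h
  exact h.symm

/-- In the variable `1 / s` the reflected denominator has the leading coefficient of `f.denom` as
its value at the origin, so `f` has a limit at infinity. Continuity bounds it on the remaining
compact set. -/
lemma exists_norm_eval_le {f : RatFunc ℝ} (hf : f ∈ RLinf) :
    ∃ C : ℝ, ∀ ω : ℝ, ‖f.eval (algebraMap ℝ ℂ) (Complex.I * (ω : ℂ))‖ ≤ C := by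
  set k := f.denom.natDegree with hk
  let N := Polynomial.reflect k f.num
  let D := Polynomial.reflect k f.denom
  let F : ℝ → ℂ := fun ω => f.eval (algebraMap ℝ ℂ) (Complex.I * (ω : ℂ))
  have hF : F = fun ω : ℝ => Polynomial.aeval (Complex.I * (ω : ℂ)) f.num /
    Polynomial.aeval (Complex.I * (ω : ℂ)) f.denom := rfl
  have hcont : Continuous F := by
    rw [hF]
    exact Continuous.div (by fun_prop) (by fun_prop) hf.2
  have hD : Polynomial.aeval (0 : ℂ) D ≠ 0 := by
    rw [← Polynomial.coeff_zero_eq_aeval_zero', Polynomial.coeff_reflect,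
      Polynomial.revAt_le (Nat.zero_le k), Nat.sub_zero, hk, Polynomial.coeff_natDegree]
    simpa using f.denom_ne_zero
  have hlim : Tendsto (fun z : ℂ => Polynomial.aeval z N / Polynomial.aeval z D) (𝓝 0)
      (𝓝 (Polynomial.aeval (0 : ℂ) N / Polynomial.aeval (0 : ℂ) D)) :=
    (Polynomial.continuous_aeval N).continuousAt.div
      (Polynomial.continuous_aeval D).continuousAt hD
  have hcob : Tendsto (fun ω : ℝ => Complex.I * (ω : ℂ)) (cocompact ℝ)
      (Bornology.cobounded ℂ) := by
    rw [← tendsto_norm_atTop_iff_cobounded]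
    refine (tendsto_norm_cocompact_atTop (E := ℝ)).congr fun ω => ?_
    rw [norm_mul, Complex.norm_I, one_mul, Complex.norm_real]
  have hF' : Tendsto F (cocompact ℝ)
      (𝓝 (Polynomial.aeval (0 : ℂ) N / Polynomial.aeval (0 : ℂ) D)) := by
    refine (hlim.comp (tendsto_inv₀_cobounded.comp hcob)).congr' ?_
    have hne : ∀ᶠ ω : ℝ in cocompact ℝ, ω ≠ 0 :=
      (isCompact_singleton (x := (0 : ℝ))).compl_mem_cocompact
    filter_upwards [hne] with ω hω
    have hz : Complex.I * (ω : ℂ) ≠ 0 := mul_ne_zero Complex.I_ne_zero (by exact_mod_cast hω)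
    simp only [Function.comp_apply, hF]
    rw [aeval_eq_aeval_inv_reflect hf.1 hz, aeval_eq_aeval_inv_reflect le_rfl hz,
      mul_div_mul_right _ _ (pow_ne_zero _ hz)]
  obtain ⟨K, hK, hKb⟩ := mem_cocompact.1
    (hF'.norm.eventually_le_const (lt_add_one _))
  obtain ⟨C, hC⟩ := hK.exists_bound_of_continuousOn hcont.continuousOn
  refine ⟨max C (‖Polynomial.aeval (0 : ℂ) N / Polynomial.aeval (0 : ℂ) D‖ + 1), fun ω => ?_⟩
  by_cases hω : ω ∈ K
  · exact (hC ω hω).trans (le_max_left _ _)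
  · exact le_trans (hKb hω) (le_max_right _ _)

end Boundedness

/-! ### Spectral norm and supremum norm -/

section SpecNorm

variable {a b c : ℕ}

lemma specNorm_nonneg (A : Matrix (Fin a) (Fin b) ℂ) : 0 ≤ specNorm A := norm_nonneg _

lemma norm_toEuclideanLin_le (A : Matrix (Fin a) (Fin b) ℂ) (v : EuclideanSpace ℂ (Fin b)) :
    ‖A.toEuclideanLin v‖ ≤ specNorm A * ‖v‖ :=
  (LinearMap.toContinuousLinearMap A.toEuclideanLin).le_opNorm v

lemma specNorm_le {A : Matrix (Fin a) (Fin b) ℂ} {C : ℝ} (hC : 0 ≤ C)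
    (h : ∀ v, ‖A.toEuclideanLin v‖ ≤ C * ‖v‖) : specNorm A ≤ C :=
  ContinuousLinearMap.opNorm_le_bound _ hC h

/-- Transfers identities between Gram matrices `Aᴴ * A` to norms of vectors. -/
lemma norm_sq_toEuclideanLin (A : Matrix (Fin a) (Fin b) ℂ) (v : EuclideanSpace ℂ (Fin b)) :
    ((‖A.toEuclideanLin v‖ ^ 2 : ℝ) : ℂ) = star v.ofLp ⬝ᵥ ((Aᴴ * A) *ᵥ v.ofLp) := by
  have h := inner_self_eq_norm_sq_to_K (𝕜 := ℂ) (A.toEuclideanLin v)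
  rw [EuclideanSpace.inner_eq_star_dotProduct] at h
  rw [← Matrix.mulVec_mulVec, Matrix.dotProduct_mulVec, ← Matrix.star_mulVec, dotProduct_comm]
  push_cast
  exact h.symm

lemma toEuclideanLin_mul (A : Matrix (Fin a) (Fin b) ℂ) (B : Matrix (Fin b) (Fin c) ℂ)
    (v : EuclideanSpace ℂ (Fin c)) :
    (A * B).toEuclideanLin v = A.toEuclideanLin (B.toEuclideanLin v) := by
  simp [Matrix.toLpLin_apply, Matrix.mulVec_mulVec]

/-- Without it the real supremum `normInf` would bound nothing, its value on an unbounded family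
being `0`. The bound comes from expanding in matrix units. -/
lemma bddAbove_specNorm {G : Matrix (Fin a) (Fin b) (RatFunc ℝ)} (hG : EntriesIn RLinf G) :
    BddAbove (Set.range fun ω : ℝ => specNorm (evalAt G (Complex.I * (ω : ℂ)))) := by
  choose C hC using fun i j => exists_norm_eval_le (hG i j)
  let L : Matrix (Fin a) (Fin b) ℂ →ₗ[ℂ] (EuclideanSpace ℂ (Fin b) →L[ℂ] EuclideanSpace ℂ (Fin a)) :=
    LinearMap.toContinuousLinearMap.toLinearMap ∘ₗ Matrix.toEuclideanLin.toLinearMap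
  refine ⟨∑ i, ∑ j, C i j * ‖L (Matrix.single i j 1)‖, ?_⟩
  rintro _ ⟨ω, rfl⟩
  change ‖L _‖ ≤ _
  conv_lhs => rw [Matrix.matrix_eq_sum_single (evalAt G (Complex.I * (ω : ℂ)))]
  rw [map_sum]
  refine norm_sum_le_of_le _ fun i _ => ?_
  rw [map_sum]
  refine norm_sum_le_of_le _ fun j _ => ?_
  rw [← mul_one (evalAt G _ i j), ← smul_eq_mul, ← Matrix.smul_single, map_smul, norm_smul]
  exact mul_le_mul_of_nonneg_right (hC i j ω) (norm_nonneg _)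

lemma normInf_nonneg (G : Matrix (Fin a) (Fin b) (RatFunc ℝ)) : 0 ≤ normInf G :=
  Real.iSup_nonneg fun _ => specNorm_nonneg _

lemma norm_evalAt_le {G : Matrix (Fin a) (Fin b) (RatFunc ℝ)} (hG : EntriesIn RLinf G) (ω : ℝ)
    (v : EuclideanSpace ℂ (Fin b)) :
    ‖(evalAt G (Complex.I * (ω : ℂ))).toEuclideanLin v‖ ≤ normInf G * ‖v‖ :=
  (norm_toEuclideanLin_le _ v).trans
    (mul_le_mul_of_nonneg_right (le_ciSup (bddAbove_specNorm hG) ω) (norm_nonneg v))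

lemma normInf_le {G : Matrix (Fin a) (Fin b) (RatFunc ℝ)} {C : ℝ} (hC : 0 ≤ C)
    (h : ∀ (ω : ℝ) (v : EuclideanSpace ℂ (Fin b)),
      ‖(evalAt G (Complex.I * (ω : ℂ))).toEuclideanLin v‖ ≤ C * ‖v‖) : normInf G ≤ C :=
  ciSup_le fun ω => specNorm_le hC (h ω)

end SpecNorm

/-! ### The adjoint on the imaginary axis -/

section Adjoint

variable {a b : ℕ}

lemma eval_C_neg_X (f : RatFunc ℝ) : f.eval RatFunc.C (-RatFunc.X) =
    ratio (f.num.comp (-Polynomial.X)) (f.denom.comp (-Polynomial.X)) := by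
  have h (p : Polynomial ℝ) : p.eval₂ RatFunc.C (-RatFunc.X) =
      algebraMap (Polynomial ℝ) (RatFunc ℝ) (p.comp (-Polynomial.X)) := by
    rw [Polynomial.comp, Polynomial.hom_eval₂]
    congr 1
    simp
  rw [RatFunc.eval, h, h, ratio]

lemma natDegree_comp_neg_X (p : Polynomial ℝ) :
    (p.comp (-Polynomial.X)).natDegree = p.natDegree := by
  simp [Polynomial.natDegree_comp]

lemma comp_neg_X_ne_zero {p : Polynomial ℝ} (hp : p ≠ 0) : p.comp (-Polynomial.X) ≠ 0 := by
  rw [Ne, ← Polynomial.leadingCoeff_eq_zero, Polynomial.leadingCoeff_comp (by simp)]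
  simpa using hp

/-- On the axis `-s` is the conjugate of `s`, and the coefficients are real. -/
lemma aeval_comp_neg_X (p : Polynomial ℝ) (ω : ℝ) :
    Polynomial.aeval (Complex.I * (ω : ℂ)) (p.comp (-Polynomial.X)) =
      star (Polynomial.aeval (Complex.I * (ω : ℂ)) p) := by
  rw [Polynomial.aeval_comp, map_neg, Polynomial.aeval_X]
  have : -(Complex.I * (ω : ℂ)) = (starRingEnd ℂ) (Complex.I * (ω : ℂ)) := by simp
  rw [this, Polynomial.aeval_conj]
  rfl

lemma adj_mem_RLinf {f : RatFunc ℝ} (hf : f ∈ RLinf) :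
    f.eval RatFunc.C (-RatFunc.X) ∈ RLinf := by
  rw [eval_C_neg_X, RLinf_eq_properOn]
  refine ratio_mem_properOn (comp_neg_X_ne_zero f.denom_ne_zero) ?_ ?_
  · rw [natDegree_comp_neg_X, natDegree_comp_neg_X]
    exact hf.1
  · rintro _ ⟨ω, rfl⟩
    simpa [aeval_comp_neg_X] using hf.2 ω

lemma EntriesIn.adj {G : Matrix (Fin a) (Fin b) (RatFunc ℝ)} (hG : EntriesIn RLinf G) :
    EntriesIn RLinf (adj G) := fun i j => adj_mem_RLinf (hG j i)

lemma evalAt_adj {G : Matrix (Fin a) (Fin b) (RatFunc ℝ)} (hG : EntriesIn RLinf G) (ω : ℝ) :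
    evalAt (adj G) (Complex.I * (ω : ℂ)) = (evalAt G (Complex.I * (ω : ℂ)))ᴴ := by
  ext i j
  change ((G j i).eval RatFunc.C (-RatFunc.X)).eval (algebraMap ℝ ℂ) _ = star (_ / _)
  have hd := (hG j i).2 ω
  rw [eval_C_neg_X, eval_ratio, aeval_comp_neg_X, aeval_comp_neg_X, star_div₀]
  · rfl
  · rw [aeval_comp_neg_X]
    exact star_ne_zero.2 hd

end Adjoint

/-! ### Pointwise norm identities on the axis -/

section AxisIdentities

variable {p q r m : ℕ}

lemma conjTranspose_mul_self_add {M : Matrix (Fin r) (Fin m) ℂ} {U : Matrix (Fin p) (Fin r) ℂ}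
    {Y : Matrix (Fin p) (Fin m) ℂ} (hU : Uᴴ * U = 1) (hY : Uᴴ * Y = 0) :
    (U * M + Y)ᴴ * (U * M + Y) = Mᴴ * M + Yᴴ * Y := by
  have hY' : Yᴴ * U = 0 := by
    rw [← Matrix.conjTranspose_eq_zero, Matrix.conjTranspose_mul,
      Matrix.conjTranspose_conjTranspose, hY]
  rw [Matrix.conjTranspose_add, Matrix.conjTranspose_mul, Matrix.mul_add, Matrix.add_mul,
    Matrix.add_mul, Matrix.mul_assoc Mᴴ, ← Matrix.mul_assoc Uᴴ, hU, Matrix.one_mul,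
    ← Matrix.mul_assoc Yᴴ, hY', Matrix.zero_mul, Matrix.mul_assoc Mᴴ, hY, Matrix.mul_zero,
    add_zero, zero_add]

lemma norm_sq_add_of_conjTranspose_mul {a₁ a₂ a₃ : ℕ} {A : Matrix (Fin a₁) (Fin m) ℂ}
    {B : Matrix (Fin a₂) (Fin m) ℂ} {C : Matrix (Fin a₃) (Fin m) ℂ}
    (h : Aᴴ * A = Bᴴ * B + Cᴴ * C) (v : EuclideanSpace ℂ (Fin m)) :
    ‖A.toEuclideanLin v‖ ^ 2 = ‖B.toEuclideanLin v‖ ^ 2 + ‖C.toEuclideanLin v‖ ^ 2 := by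
  apply Complex.ofReal_injective
  rw [Complex.ofReal_add, norm_sq_toEuclideanLin, norm_sq_toEuclideanLin, norm_sq_toEuclideanLin, h,
    Matrix.add_mulVec, dotProduct_add]

variable {T : Matrix (Fin p) (Fin m) (RatFunc ℝ)} {U : Matrix (Fin p) (Fin r) (RatFunc ℝ)}
  {W : Matrix (Fin r) (Fin m) (RatFunc ℝ)}

lemma EntriesIn.residual (hT : EntriesIn RLinf T) (hU : EntriesIn RLinf U) :
    EntriesIn RLinf (residual U T) := by
  have hU' := hU.adj
  rw [RLinf_eq_properOn] at *
  exact (entriesIn_one.sub (hU.mul hU')).mul hT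

/-- Pythagoras: the component in the range of `U` is carried isometrically, and the residual is
orthogonal to that range. -/
lemma norm_sq_error (hT : EntriesIn RLinf T) (hU : IsInner U) (hW : EntriesIn RLinf W) (ω : ℝ)
    (v : EuclideanSpace ℂ (Fin m)) :
    ‖(evalAt (T - U * W) (Complex.I * (ω : ℂ))).toEuclideanLin v‖ ^ 2 =
      ‖(evalAt (adj U * T - W) (Complex.I * (ω : ℂ))).toEuclideanLin v‖ ^ 2 +
        ‖(evalAt (residual U T) (Complex.I * (ω : ℂ))).toEuclideanLin v‖ ^ 2 := by
  have hUr := hU.1.mono stable_subset_RLinf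
  have hUa := hUr.adj
  have hYr := hT.residual hUr
  have ha := evalAt_adj hUr ω
  have hs : Complex.I * (ω : ℂ) ∈ imaginaryAxis := ⟨ω, rfl⟩
  rw [RLinf_eq_properOn] at hT hW hUr hUa hYr
  have hunit : (evalAt U (Complex.I * (ω : ℂ)))ᴴ * evalAt U (Complex.I * (ω : ℂ)) = 1 := by
    rw [← ha, ← evalAt_mul hUa hUr hs, hU.2, evalAt_one]
  have horth : (evalAt U (Complex.I * (ω : ℂ)))ᴴ * evalAt (residual U T) (Complex.I * (ω : ℂ)) =
      0 := by
    have h0 : adj U * residual U T = 0 := by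
      rw [residual, ← Matrix.mul_assoc, Matrix.mul_sub, ← Matrix.mul_assoc, hU.2, Matrix.mul_one,
        Matrix.one_mul, sub_self, Matrix.zero_mul]
    rw [← ha, ← evalAt_mul hUa hYr hs, h0, evalAt_zero]
  have hdec : T - U * W = U * (adj U * T - W) + residual U T := by
    rw [residual, Matrix.sub_mul, Matrix.mul_sub, Matrix.one_mul, Matrix.mul_assoc]
    abel
  have hM : EntriesIn (properOn imaginaryAxis) (adj U * T - W) := (hUa.mul hT).sub hW
  have hev : evalAt (T - U * W) (Complex.I * (ω : ℂ)) =
      evalAt U (Complex.I * (ω : ℂ)) * evalAt (adj U * T - W) (Complex.I * (ω : ℂ)) +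
        evalAt (residual U T) (Complex.I * (ω : ℂ)) := by
    rw [hdec, evalAt_add (hUr.mul hM) hYr hs, evalAt_mul hUr hM hs]
  rw [hev]
  exact norm_sq_add_of_conjTranspose_mul (conjTranspose_mul_self_add hunit horth) v

lemma norm_sq_spectralFactor {Y : Matrix (Fin p) (Fin m) (RatFunc ℝ)} (hY : EntriesIn RLinf Y)
    {β : ℝ} {H : Matrix (Fin m) (Fin m) (RatFunc ℝ)}
    (hH : IsSpectralFactor
      (RatFunc.C (β ^ 2) • (1 : Matrix (Fin m) (Fin m) (RatFunc ℝ)) - adj Y * Y) H) (ω : ℝ)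
    (v : EuclideanSpace ℂ (Fin m)) :
    (β * ‖v‖) ^ 2 = ‖(evalAt H (Complex.I * (ω : ℂ))).toEuclideanLin v‖ ^ 2 +
      ‖(evalAt Y (Complex.I * (ω : ℂ))).toEuclideanLin v‖ ^ 2 := by
  have hHr := hH.1.mono stable_subset_RLinf
  have hHa := hHr.adj
  have hYa := hY.adj
  have haH := evalAt_adj hHr ω
  have haY := evalAt_adj hY ω
  have hs : Complex.I * (ω : ℂ) ∈ imaginaryAxis := ⟨ω, rfl⟩
  rw [RLinf_eq_properOn] at hY hHr hHa hYa
  have hC : EntriesIn (properOn imaginaryAxis)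
      (RatFunc.C (β ^ 2) • (1 : Matrix (Fin m) (Fin m) (RatFunc ℝ))) := fun i j =>
    (properRing imaginaryAxis).mul_mem (C_mem_properOn _) (entriesIn_one i j)
  have h := congrArg (fun G => evalAt G (Complex.I * (ω : ℂ))) hH.2.2.2
  simp only [evalAt_sub hC (hYa.mul hY) hs, evalAt_mul hYa hY hs, evalAt_mul hHa hHr hs, haH,
    haY] at h
  -- `β² I` is written as a Gram matrix to fit `norm_sq_add_of_conjTranspose_mul`.
  have hsc : evalAt (RatFunc.C (β ^ 2) • (1 : Matrix (Fin m) (Fin m) (RatFunc ℝ)))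
      (Complex.I * (ω : ℂ)) =
        (((β : ℂ) • (1 : Matrix (Fin m) (Fin m) ℂ))ᴴ * ((β : ℂ) • (1 : Matrix (Fin m) (Fin m) ℂ)))
      := by
    ext i j
    by_cases hij : i = j
    · subst hij
      simp only [evalAt, Matrix.map_apply, Matrix.smul_apply, Matrix.one_apply_eq, smul_eq_mul,
        mul_one, RatFunc.eval_C]
      simp [pow_two]
    · simp [evalAt, hij]
  rw [hsc, sub_eq_iff_eq_add] at h
  have h2 := norm_sq_add_of_conjTranspose_mul h v
  rw [← h2, map_smul, LinearMap.smul_apply, norm_smul, mul_pow, mul_pow, Complex.norm_real,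
    Real.norm_eq_abs, sq_abs]
  simp

end AxisIdentities

/-! ### Error bounds and the rank of the outer factor -/

section ModelMatchingBounds

variable {p q r m : ℕ} {T₁ : Matrix (Fin p) (Fin m) (RatFunc ℝ)}
  {U : Matrix (Fin p) (Fin r) (RatFunc ℝ)} {V : Matrix (Fin r) (Fin q) (RatFunc ℝ)}
  {W : Matrix (Fin r) (Fin m) (RatFunc ℝ)} {H : Matrix (Fin m) (Fin m) (RatFunc ℝ)} {β : ℝ}

lemma EntriesIn.error (hT : EntriesIn RLinf T₁) (hU : IsInner U) (hW : EntriesIn RLinf W) :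
    EntriesIn RLinf (T₁ - U * W) := by
  have hUr := hU.1.mono stable_subset_RLinf
  rw [RLinf_eq_properOn] at *
  exact hT.sub (hUr.mul hW)

lemma normInf_residual_le (hT : EntriesIn RLinf T₁) (hU : IsInner U) (hW : EntriesIn RLinf W) :
    normInf (residual U T₁) ≤ normInf (T₁ - U * W) := by
  refine normInf_le (normInf_nonneg _) fun ω v => le_trans ?_ (norm_evalAt_le (hT.error hU hW) ω v)
  refine le_of_sq_le_sq ?_ (norm_nonneg _)
  rw [norm_sq_error hT hU hW]
  exact le_add_of_nonneg_left (sq_nonneg _)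

/-- The pointwise comparison on the imaginary axis of the error `T₁ - U W` with the
normalised error `U^* T₁ H⁻¹ - W H⁻¹`. -/
lemma norm_sq_error_spectralFactor (hT : EntriesIn RLinf T₁) (hU : IsInner U)
    (hW : EntriesIn RLinf W)
    (hH : IsSpectralFactor (RatFunc.C (β ^ 2) • (1 : Matrix (Fin m) (Fin m) (RatFunc ℝ)) -
      adj (residual U T₁) * residual U T₁) H) (ω : ℝ) (v : EuclideanSpace ℂ (Fin m)) :
    ‖(evalAt (T₁ - U * W) (Complex.I * (ω : ℂ))).toEuclideanLin v‖ ^ 2 =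
      ‖(evalAt (adj U * T₁ * H⁻¹ - W * H⁻¹) (Complex.I * (ω : ℂ))).toEuclideanLin
          ((evalAt H (Complex.I * (ω : ℂ))).toEuclideanLin v)‖ ^ 2 + (β * ‖v‖) ^ 2 -
        ‖(evalAt H (Complex.I * (ω : ℂ))).toEuclideanLin v‖ ^ 2 := by
  have hUr := hU.1.mono stable_subset_RLinf
  have hUa := hUr.adj
  have hHr := hH.1.mono stable_subset_RLinf
  have hHi := hH.2.2.1.mono stable_subset_RLinf
  rw [norm_sq_error hT hU hW, norm_sq_spectralFactor (hT.residual hUr) hH, ← toEuclideanLin_mul]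
  rw [RLinf_eq_properOn] at *
  have hs : Complex.I * (ω : ℂ) ∈ imaginaryAxis := ⟨ω, rfl⟩
  rw [← evalAt_mul (((hUa.mul hT).mul hHi).sub (hW.mul hHi)) hHr hs, Matrix.sub_mul,
    Matrix.mul_assoc _ H⁻¹, Matrix.mul_assoc _ H⁻¹, Matrix.nonsing_inv_mul _ hH.2.1,
    Matrix.mul_one, Matrix.mul_one]
  ring

lemma normInf_error_le (hT : EntriesIn RLinf T₁) (hU : IsInner U) (hW : EntriesIn RLinf W)
    (hβ : 0 ≤ β)
    (hH : IsSpectralFactor (RatFunc.C (β ^ 2) • (1 : Matrix (Fin m) (Fin m) (RatFunc ℝ)) -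
      adj (residual U T₁) * residual U T₁) H)
    (h : normInf (adj U * T₁ * H⁻¹ - W * H⁻¹) ≤ 1) : normInf (T₁ - U * W) ≤ β := by
  have hUa := (hU.1.mono stable_subset_RLinf).adj
  have hHi := hH.2.2.1.mono stable_subset_RLinf
  have hN : EntriesIn RLinf (adj U * T₁ * H⁻¹ - W * H⁻¹) := by
    rw [RLinf_eq_properOn] at *
    exact ((hUa.mul hT).mul hHi).sub (hW.mul hHi)
  refine normInf_le hβ fun ω v => le_of_sq_le_sq ?_ (mul_nonneg hβ (norm_nonneg v))
  rw [norm_sq_error_spectralFactor hT hU hW hH]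
  have h1 := norm_evalAt_le hN ω ((evalAt H (Complex.I * (ω : ℂ))).toEuclideanLin v)
  have h2 := pow_le_pow_left₀ (norm_nonneg _)
    (h1.trans (mul_le_of_le_one_left (norm_nonneg _) h)) 2
  linarith

/-- A strict bound on a supremum needs a uniform margin. For `w = H v` the comparison identity gives
`|(R - X) w|² ≤ |w|² - (β² - b²)|v|²`, and `|w| ≤ c|v|` turns the loss into a fixed fraction `δ` of
`|w|²`. -/
lemma normInf_normalised_lt_one (hT : EntriesIn RLinf T₁) (hU : IsInner U)
    (hW : EntriesIn RLinf W)
    (hH : IsSpectralFactor (RatFunc.C (β ^ 2) • (1 : Matrix (Fin m) (Fin m) (RatFunc ℝ)) -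
      adj (residual U T₁) * residual U T₁) H)
    (h : normInf (T₁ - U * W) < β) : normInf (adj U * T₁ * H⁻¹ - W * H⁻¹) < 1 := by
  have hHr := hH.1.mono stable_subset_RLinf
  have hHi := hH.2.2.1.mono stable_subset_RLinf
  set b := normInf (T₁ - U * W) with hb
  have hb0 : 0 ≤ b := normInf_nonneg _
  -- Adding `β` keeps `c` positive even when `normInf H = 0`, as for `m = 0`.
  set c := normInf H + β with hc
  have hc0 : 0 < c := add_pos_of_nonneg_of_pos (normInf_nonneg _) (hb0.trans_lt h)
  have hHc : normInf H ≤ c := le_add_of_nonneg_right (hb0.trans h.le)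
  have hδ : 0 < (β ^ 2 - b ^ 2) / c ^ 2 :=
    div_pos (sub_pos.2 (pow_lt_pow_left₀ h hb0 two_ne_zero)) (pow_pos hc0 2)
  set δ := (β ^ 2 - b ^ 2) / c ^ 2 with hδdef
  have hlt : Real.sqrt (1 - δ) < 1 := by
    rw [Real.sqrt_lt' one_pos]
    linarith
  refine lt_of_le_of_lt (normInf_le (Real.sqrt_nonneg _) fun ω w => ?_) hlt
  set v := (evalAt H⁻¹ (Complex.I * (ω : ℂ))).toEuclideanLin w with hv
  have hHv : (evalAt H (Complex.I * (ω : ℂ))).toEuclideanLin v = w := by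
    rw [RLinf_eq_properOn] at hHr hHi
    rw [hv, ← toEuclideanLin_mul, ← evalAt_mul hHr hHi ⟨ω, rfl⟩, Matrix.mul_nonsing_inv _ hH.2.1,
      evalAt_one]
    simp
  have h1 := norm_sq_error_spectralFactor hT hU hW hH ω v
  have h2 := pow_le_pow_left₀ (norm_nonneg _) (norm_evalAt_le (hT.error hU hW) ω v) 2
  have h3 := (norm_evalAt_le hHr ω v).trans (mul_le_mul_of_nonneg_right hHc (norm_nonneg v))
  rw [hHv] at h1 h3
  have h4 : δ * ‖w‖ ^ 2 ≤ (β ^ 2 - b ^ 2) * ‖v‖ ^ 2 := by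
    have h5 := mul_le_mul_of_nonneg_left (pow_le_pow_left₀ (norm_nonneg _) h3 2) hδ.le
    refine h5.trans (le_of_eq ?_)
    rw [hδdef]
    field_simp
  have h6 : ‖(evalAt (adj U * T₁ * H⁻¹ - W * H⁻¹) (Complex.I * (ω : ℂ))).toEuclideanLin w‖ ^ 2 ≤
      (1 - δ) * ‖w‖ ^ 2 := by
    rw [← hb] at h2
    nlinarith [h1, h2, h4]
  -- The sign of `1 - δ` is irrelevant: only the factor `‖w‖ ^ 2` has to be nonnegative.
  rw [← Real.sqrt_sq (norm_nonneg w), ← Real.sqrt_mul' _ (sq_nonneg _)]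
  exact Real.le_sqrt_of_sq_le h6

/-- At an axis point where `V` has rank `r`, so has `U * V`, because `U^*` is a left inverse of `U`.
Constancy spreads rank `r` over the axis and infinity, and the rank of a product is at most that of
`V`. -/
lemma rank_evalAt_outer_eq (hU : IsInner U) (hV : IsOuter V)
    (hrank : ConstantRankOnAxis (U * V)) :
    (∀ s : ℂ, 0 ≤ s.re → (evalAt V s).rank = r) ∧ (evalInfty V).rank = r := by
  have hUs : EntriesIn (properOn closedRightHalfPlane) U := hU.1
  have hVs : EntriesIn (properOn closedRightHalfPlane) V := hV.1
  have hUr := hU.1.mono stable_subset_RLinf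
  have hUa := hUr.adj
  have haxis (ω : ℝ) : Complex.I * (ω : ℂ) ∈ closedRightHalfPlane := imaginaryAxis_subset ⟨ω, rfl⟩
  have hinfty : (evalInfty (U * V)).rank = r := by
    obtain ⟨ω, hω⟩ := hV.exists_axis_rank
    rw [← hrank ω, evalAt_mul hUs hVs (haxis ω)]
    refine le_antisymm ((Matrix.rank_mul_le_right _ _).trans_eq hω) ?_
    have hleft : evalAt (adj U) (Complex.I * (ω : ℂ)) * (evalAt U (Complex.I * (ω : ℂ)) *
        evalAt V (Complex.I * (ω : ℂ))) = evalAt V (Complex.I * (ω : ℂ)) := by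
      rw [RLinf_eq_properOn] at hUr hUa
      rw [← Matrix.mul_assoc, ← evalAt_mul hUa hUr ⟨ω, rfl⟩, hU.2, evalAt_one, Matrix.one_mul]
    conv_lhs => rw [← hω, ← hleft]
    exact Matrix.rank_mul_le_right _ _
  refine ⟨fun s hs => ?_, ?_⟩
  · rcases hs.lt_or_eq with hs | hs
    · exact hV.2 s hs
    · have hsω : s = Complex.I * (s.im : ℂ) := by
        apply Complex.ext <;> simp [← hs]
      refine le_antisymm (by simpa using (evalAt V s).rank_le_card_height) ?_
      rw [hsω]
      have h := hrank s.im
      rw [hinfty, evalAt_mul hUs hVs (haxis s.im)] at h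
      conv_lhs => rw [← h]
      exact Matrix.rank_mul_le_right _ _
  · refine le_antisymm (by simpa using (evalInfty V).rank_le_card_height) ?_
    rw [evalInfty_mul hUs hVs] at hinfty
    conv_lhs => rw [← hinfty]
    exact Matrix.rank_mul_le_right _ _

end ModelMatchingBounds

end ModelMatching

end

/-! ### The model-matching theorem -/

theorem mainTheorem1 {p q r m : ℕ}
    (T₁ : Matrix (Fin p) (Fin m) (RatFunc ℝ)) (T₂ : Matrix (Fin p) (Fin q) (RatFunc ℝ))
    (hT₁ : ModelMatching.EntriesIn ModelMatching.RLinf T₁)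
    (hT₂ : ModelMatching.EntriesIn ModelMatching.stable T₂)
    (hrank : ModelMatching.ConstantRankOnAxis T₂)
    (Ui : Matrix (Fin p) (Fin r) (RatFunc ℝ)) (Uo : Matrix (Fin r) (Fin q) (RatFunc ℝ))
    (hUi : ModelMatching.IsInner Ui) (hUo : ModelMatching.IsOuter Uo) (hfac : T₂ = Ui * Uo)
    (Y : Matrix (Fin p) (Fin m) (RatFunc ℝ)) (hY : Y = ModelMatching.residual Ui T₁)
    (Yo : ℝ → Matrix (Fin m) (Fin m) (RatFunc ℝ))
    (hYo : ∀ β : ℝ, ModelMatching.normInf Y < β →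
      ModelMatching.IsSpectralFactor
        (RatFunc.C (β ^ 2) • (1 : Matrix (Fin m) (Fin m) (RatFunc ℝ)) - ModelMatching.adj Y * Y)
        (Yo β))
    (R : ℝ → Matrix (Fin r) (Fin m) (RatFunc ℝ))
    (hR : ∀ β : ℝ, R β = ModelMatching.adj Ui * T₁ * (Yo β)⁻¹) :
    IsGLB {β : ℝ | ModelMatching.normInf Y < β ∧ ModelMatching.distStable (R β) < 1}
        (ModelMatching.matchingError T₁ T₂) ∧
      ∀ β : ℝ, ModelMatching.matchingError T₁ T₂ < β →
        ∀ X : Matrix (Fin r) (Fin m) (RatFunc ℝ), ModelMatching.EntriesIn ModelMatching.stable X →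
          ModelMatching.normInf (R β - X) ≤ 1 →
          (∃ Q : Matrix (Fin q) (Fin m) (RatFunc ℝ),
            ModelMatching.EntriesIn ModelMatching.stable Q ∧ X = Uo * Q * (Yo β)⁻¹) ∧
          ∀ Q : Matrix (Fin q) (Fin m) (RatFunc ℝ),
            ModelMatching.EntriesIn ModelMatching.stable Q → X = Uo * Q * (Yo β)⁻¹ →
            ModelMatching.normInf (T₁ - T₂ * Q) ≤ β := by
  open ModelMatching in
  subst hfac hY
  obtain ⟨hfin, hinf⟩ := rank_evalAt_outer_eq hUi hUo hrank
  obtain ⟨V, hV, hUV⟩ := exists_stable_right_inverse Uo hUo.1 hfin hinf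
  have hstable0 (a b : ℕ) : EntriesIn stable (0 : Matrix (Fin a) (Fin b) (RatFunc ℝ)) :=
    fun _ _ => (properRing closedRightHalfPlane).zero_mem
  have hW {Q : Matrix (Fin q) (Fin m) (RatFunc ℝ)} (hQ : EntriesIn stable Q) :
      EntriesIn stable (Uo * Q) := EntriesIn.mul (Z := closedRightHalfPlane) hUo.1 hQ
  have hWr {Q : Matrix (Fin q) (Fin m) (RatFunc ℝ)} (hQ : EntriesIn stable Q) :
      EntriesIn RLinf (Uo * Q) := (hW hQ).mono stable_subset_RLinf
  have hbdd : BddBelow (Set.range fun Q : {Q : Matrix (Fin q) (Fin m) (RatFunc ℝ) //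
      EntriesIn stable Q} => normInf (T₁ - Ui * Uo * Q.1)) := by
    refine ⟨0, ?_⟩
    rintro _ ⟨Q, rfl⟩
    exact normInf_nonneg _
  have : Nonempty {Q : Matrix (Fin q) (Fin m) (RatFunc ℝ) // EntriesIn stable Q} :=
    ⟨⟨0, hstable0 _ _⟩⟩
  have : Nonempty {X : Matrix (Fin r) (Fin m) (RatFunc ℝ) // EntriesIn stable X} :=
    ⟨⟨0, hstable0 _ _⟩⟩
  -- Thus every `β > γ` exceeds `‖Y‖∞`, and `hYo` supplies its spectral factor.
  have hYγ : normInf (residual Ui T₁) ≤ matchingError T₁ (Ui * Uo) := by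
    refine le_ciInf fun Q => ?_
    rw [Matrix.mul_assoc]
    exact normInf_residual_le hT₁ hUi (hWr Q.2)
  have hex (β : ℝ) (hβ : normInf (residual Ui T₁) < β) (X : Matrix (Fin r) (Fin m) (RatFunc ℝ))
      (hX : EntriesIn stable X) : ∃ Q : Matrix (Fin q) (Fin m) (RatFunc ℝ),
        EntriesIn stable Q ∧ X = Uo * Q * (Yo β)⁻¹ := by
    refine ⟨V * (X * Yo β), EntriesIn.mul (Z := closedRightHalfPlane) hV
      (EntriesIn.mul (Z := closedRightHalfPlane) hX (hYo β hβ).1), ?_⟩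
    rw [← Matrix.mul_assoc, hUV, Matrix.one_mul, Matrix.mul_assoc,
      Matrix.mul_nonsing_inv _ (hYo β hβ).2.1, Matrix.mul_one]
  have hbound (β : ℝ) (hβ : normInf (residual Ui T₁) < β)
      (X : Matrix (Fin r) (Fin m) (RatFunc ℝ)) (hRX : normInf (R β - X) ≤ 1)
      (Q : Matrix (Fin q) (Fin m) (RatFunc ℝ)) (hQ : EntriesIn stable Q)
      (hXQ : X = Uo * Q * (Yo β)⁻¹) : normInf (T₁ - Ui * Uo * Q) ≤ β := by
    rw [Matrix.mul_assoc]
    rw [hXQ, hR] at hRX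
    exact normInf_error_le hT₁ hUi (hWr hQ) ((normInf_nonneg _).trans hβ.le) (hYo β hβ) hRX
  refine ⟨⟨?_, fun l hl => ?_⟩, fun β hβ X hX hRX =>
    ⟨hex β (hYγ.trans_lt hβ) X hX, hbound β (hYγ.trans_lt hβ) X hRX⟩⟩
  · rintro β ⟨hβ, hdist⟩
    obtain ⟨⟨X, hX⟩, hRX⟩ := exists_lt_of_ciInf_lt hdist
    obtain ⟨Q, hQ, hXQ⟩ := hex β hβ X hX
    exact (ciInf_le hbdd ⟨Q, hQ⟩).trans (hbound β hβ X hRX.le Q hQ hXQ)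
  -- Every `β > γ` lies in the set, so a lower bound `l` is at most each such `β`, hence at most
  -- `γ`. This also shows that the set is non-empty.
  · refine le_of_forall_gt_imp_ge_of_dense fun β hβ => hl ⟨hYγ.trans_lt hβ, ?_⟩
    obtain ⟨⟨Q, hQ⟩, hlt⟩ := exists_lt_of_ciInf_lt hβ
    have hH := hYo β (hYγ.trans_lt hβ)
    rw [Matrix.mul_assoc] at hlt
    have hlt1 := normInf_normalised_lt_one hT₁ hUi (hWr hQ) hH hlt
    rw [← hR] at hlt1
    refine lt_of_le_of_lt (ciInf_le ⟨0, ?_⟩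
      (⟨Uo * Q * (Yo β)⁻¹, EntriesIn.mul (Z := closedRightHalfPlane) (hW hQ) hH.2.2.1⟩ :
        {X : Matrix (Fin r) (Fin m) (RatFunc ℝ) // EntriesIn stable X})) hlt1
    rintro _ ⟨X, rfl⟩
    exact normInf_nonneg _
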